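/- Let $K$ be an algebraically closed field and $\Lambda$ a basic finite dimensional $K$-algebra with Jacobson radical $J$ and a complete set $e_1,\dots,e_n$ of orthogonal primitive idempotents (so $\Lambda/J\cong K^n$, the $e_i$ mapping to the standard idempotents), and let $L\ge 0$ be minimal with $J^{L+1}=0$. For a finite dimensional left $\Lambda$-module $M$ write $\underline{\dim}\,M=(\dim_K e_iM)_{1\le i\le n}$, and $|\mathbf v|=\sum_i v_i$ for $\mathbf v\in\mathbb N^n$. Let $\mathbb S=(\mathbb S_0,\dots,\mathbb S_L)$ be a sequence of finite dimensional semisimple $\Lambda$-modules, $\mathbf d=\sum_{l=0}^{L}\underline{\dim}\,\mathbb S_l$, and let $\mathbf P$ be a finite dimensional projective $\Lambda$-module with $\underline{\dim}(\mathbf P/J\mathbf P)=\mathbf d$. Let $\mathrm{GRASS}(\mathbb S)$ be the set of points $C$ of the Grassmannian $\mathrm{Gr}(\dim\mathbf P-|\mathbf d|,\mathbf P)$ of subspaces of dimension $\dim \mathbf P-|\mathbf d|$ which are $\Lambda$-submodules of $\mathbf P$ with $\underline{\dim}(\mathbf P/C)=\mathbf d$ and $J^l(\mathbf P/C)/J^{l+1}(\mathbf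 P/C)\cong\mathbb S_l$ for $0\le l\le L$, with the structure induced from the Grassmannian. For $0\le i\le L+1$ put $\partial_i=(\dim\mathbf P-|\mathbf d|)+\sum_{l=L+1-i}^{L}|\underline{\dim}\,\mathbb S_l|$, and let $\mathfrak U$ be the subset of the partial flag variety $\mathrm{Flag}(\partial_0,\dots,\partial_{L+1},\mathbf P)$ consisting of the flags of $\Lambda$-submodules $$0\subseteq D_{L+1}\subseteq D_L\subseteq\dots\subseteq D_0=\mathbf P\quad\text{with}\quad D_l/D_{l+1}\cong\mathbb S_l\ \text{ for }0\le l\le L .$$ Then $\mathfrak U$ is Zariski closed in $\mathrm{Flag}(\partial_0,\dots,\partial_{L+1},\mathbf P)$. Moreover, the assignment $$\Phi(C)=(C+J^{L+1}\mathbf P,\;C+J^{L}\mathbf P,\;\dots,\;C+J\mathbf P,\;C+J^{0}\mathbf P)$$ defines an embedding of varieties $\Phi:\mathrm{GRASS}(\mathbb S)\to\mathfrak U$: it is a morphism with locally closed image, and it induces an isomorphism of varieties from $\mathrm{GRASS}(\mathbb S)$ onto its image. -/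

import Mathlib

open scoped Topology

noncomputable section

/-- A space with functions over `K`: a topology together with, for every open set `U`, a notion of
regular function on `U`. A regular function on `U` is written as a function on all of `X`, of which
only the values on `U` matter. Classical (reduced) varieties are such spaces. -/
structure KSpace (K : Type*) (X : Type*) where
  /-- the Zariski topology -/
  top : TopologicalSpace X
  /-- `RegularOn U f`: the restriction of `f` to the open set `U` is a regular function -/
  RegularOn : Set X → (X → K) → Prop

/-- Polynomial functions on a finite dimensional vector space: the algebra of functions generated
by the linear forms. -/
def polyFun (K : Type*) [Field K] (W : Type*) [AddCommGroup W] [Module K W] :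
    Subalgebra K (W → K) :=
  Algebra.adjoin K (Set.range fun φ : Module.Dual K W => (φ : W → K))

namespace KSpace

/-- A finite dimensional vector space as affine space: the Zariski topology is generated by the
basic open sets `p ≠ 0`, and a regular function is locally a quotient of polynomial functions. -/
def affine (K : Type*) [Field K] (W : Type*) [AddCommGroup W] [Module K W] : KSpace K W where
  top := TopologicalSpace.generateFrom {U | ∃ p ∈ polyFun K W, U = {x | p x ≠ 0}}
  RegularOn U f := ∀ x ∈ U, ∃ p ∈ polyFun K W, ∃ q ∈ polyFun K W,
    q x ≠ 0 ∧ ∀ y ∈ U, q y ≠ 0 → f y = p y / q y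

/-- The structure of a subspace (along an injection `j`): the induced topology, and the functions
which are locally restrictions of regular functions on open sets of the ambient space. -/
def induced {K X Y : Type*} (j : Y → X) (A : KSpace K X) : KSpace K Y where
  top := A.top.induced j
  RegularOn U f := ∀ y ∈ U, ∃ O : Set X, IsOpen[A.top] O ∧ j y ∈ O ∧
    ∃ g : X → K, A.RegularOn O g ∧ ∀ z ∈ U, j z ∈ O → f z = g (j z)

/-- The structure of a quotient (along a surjection `π`): the quotient topology, and the functions
which become regular after composition with `π`. -/
def coinduced {K X Y : Type*} (π : Y → X) (A : KSpace K Y) : KSpace K X where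
  top := A.top.coinduced π
  RegularOn U f := A.RegularOn (π ⁻¹' U) (f ∘ π)

/-- The structure of a subset of a space with functions. -/
def sub {K X : Type*} (A : KSpace K X) (s : Set X) : KSpace K s := A.induced Subtype.val

/-- Morphisms: continuous maps that pull regular functions back to regular functions. -/
structure IsMorphism {K X Y : Type*} (A : KSpace K X) (B : KSpace K Y) (f : X → Y) : Prop where
  continuous : Continuous[A.top, B.top] f
  comp : ∀ U : Set Y, IsOpen[B.top] U → ∀ g : Y → K, B.RegularOn U g →
    A.RegularOn (f ⁻¹' U) (g ∘ f)

/-- Isomorphisms: morphisms with an inverse morphism. -/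
def IsIso {K X Y : Type*} (A : KSpace K X) (B : KSpace K Y) (f : X → Y) : Prop :=
  IsMorphism A B f ∧
    ∃ g : Y → X, Function.LeftInverse g f ∧ Function.RightInverse g f ∧ IsMorphism B A g

/-- Embeddings of varieties: morphisms whose image is locally closed (so that it is a subvariety)
and which induce an isomorphism onto the image. -/
structure IsEmbedding {K X Y : Type*} (A : KSpace K X) (B : KSpace K Y) (f : X → Y) : Prop where
  isMorphism : IsMorphism A B f
  isLocallyClosed_range : @IsLocallyClosed Y B.top (Set.range f)
  isIso : IsIso A (B.sub (Set.range f)) (Set.rangeFactorization f)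

end KSpace

section Grassmannians

variable (K : Type*) [Field K] (V : Type*) [AddCommGroup V] [Module K V]

/-- The Grassmannian of `k`-dimensional subspaces of `V`. -/
def Gr (k : ℕ) : Type _ := {D : Submodule K V // Module.finrank K D = k}

/-- Linearly independent `k`-tuples of vectors of `V`, an open subset of the affine space
`Fin k → V`. -/
def Frame (k : ℕ) : Type _ := {v : Fin k → V // LinearIndependent K v}

variable {K V} in
/-- The subspace spanned by a frame. -/
def Frame.span {k : ℕ} (v : Frame K V k) : Gr K V k :=
  ⟨Submodule.span K (Set.range v.1), by
    simpa using finrank_span_eq_card (R := K) v.2⟩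

/-- The Grassmannian as a variety: the quotient of the variety of frames by the general linear
group (the fibres of `Frame.span` are its orbits). -/
def grVariety (k : ℕ) : KSpace K (Gr K V k) :=
  ((KSpace.affine K (Fin k → V)).induced
    (fun v : Frame K V k => v.1)).coinduced Frame.span

/-- The product variety of finitely many Grassmannians of `V`: the quotient of the product of the
varieties of frames (an open subset of an affine space) by the product of the general linear
groups. -/
def grProdVariety {ι : Type*} (k : ι → ℕ) : KSpace K (∀ i, Gr K V (k i)) :=
  ((KSpace.affine K (∀ i, Fin (k i) → V)).induced
    (fun (v : ∀ i, Frame K V (k i)) i => (v i).1)).coinduced fun v i => (v i).span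

/-- Partial flags `F 0 ⊆ F 1 ⊆ ⋯` of subspaces of `V` with `dim (F i) = k i`. -/
def PartialFlag {m : ℕ} (k : Fin m → ℕ) : Set (∀ i, Gr K V (k i)) :=
  {F | ∀ i j, i ≤ j → (F i).1 ≤ (F j).1}

/-- The partial flag variety, as a subvariety of the product of Grassmannians. -/
def flagVariety {m : ℕ} (k : Fin m → ℕ) : KSpace K (PartialFlag K V k) :=
  (grProdVariety K V k).sub (PartialFlag K V k)

end Grassmannians

section Modules

variable (K : Type*) [Field K] {Λ : Type*} [Ring Λ] [Algebra K Λ] {n : ℕ}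

/-- `Λ` is basic with (complete, orthogonal) primitive idempotents `e 0, …, e (n - 1)`: modulo the
Jacobson radical, `Λ` is `K × ⋯ × K` with the classes of the `e i` as standard idempotents. -/
structure IsBasicAlgebra (e : Fin n → Λ) : Prop where
  complete : CompleteOrthogonalIdempotents e
  quotient : ∃ φ : Λ →ₐ[K] (Fin n → K), Function.Surjective φ ∧
    (∀ x, φ x = 0 ↔ x ∈ Ring.jacobson Λ) ∧ ∀ i, φ (e i) = Pi.single i 1

/-- The dimension vector of a `Λ`-module `M`: its `i`-th entry is `dim (e i) M`, the multiplicity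
of the `i`-th simple module as a composition factor of `M`. -/
def dimVec (e : Fin n → Λ) (M : Type*) [AddCommGroup M] [Module K M] [Module Λ M]
    [IsScalarTower K Λ M] (i : Fin n) : ℕ :=
  Module.finrank K (LinearMap.range (Algebra.lsmul K K M (e i)))

variable (Λ) in
/-- The power `J ^ l` of the Jacobson radical `J` of `Λ`. -/
def radIdeal (l : ℕ) : Ideal Λ := Ring.jacobson Λ ^ l

variable (Λ) in
/-- The submodule `J ^ l M` of `M`, where `J` is the Jacobson radical of `Λ`. -/
def radPow (M : Type*) [AddCommGroup M] [Module Λ M] (l : ℕ) : Submodule Λ M :=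
  radIdeal Λ l • (⊤ : Submodule Λ M)

/-- The quotient `A / (A ∩ B)` of submodules of `M` (this is `A / B` if `B ⊆ A`). -/
abbrev subQuot {M : Type*} [AddCommGroup M] [Module Λ M] (A B : Submodule Λ M) : Type _ :=
  A ⧸ B.submoduleOf A

variable (Λ) in
/-- `M` has radical layering `S`: `J ^ l M / J ^ (l + 1) M ≅ S l` for `0 ≤ l ≤ L`. -/
def HasRadicalLayering (M : Type*) [AddCommGroup M] [Module Λ M] {L : ℕ} (S : Fin (L + 1) → Type*)
    [∀ l, AddCommGroup (S l)] [∀ l, Module Λ (S l)] : Prop :=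
  ∀ l : Fin (L + 1), Nonempty (subQuot (radPow Λ M l) (radPow Λ M (l + 1)) ≃ₗ[Λ] S l)

variable (P : Type*) [AddCommGroup P] [Module K P] [Module Λ P] [IsScalarTower K Λ P]

/-- The set `GRASS_d(Λ)` of `Λ`-submodules `C` of `P` such that `P / C` has dimension vector `d`. -/
def moduleGrass (e : Fin n → Λ) (d : Fin n → ℕ) :
    Set (Gr K P (Module.finrank K P - ∑ i, d i)) :=
  {C | ∃ C' : Submodule Λ P, C'.restrictScalars K = C.1 ∧ dimVec K e (P ⧸ C') = d}

variable {L : ℕ} (S : Fin (L + 1) → Type*)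
  [∀ l, AddCommGroup (S l)] [∀ l, Module K (S l)] [∀ l, Module Λ (S l)]
  [∀ l, IsScalarTower K Λ (S l)]

/-- The set `GRASS(S)` of those `C` in `GRASS_d(Λ)` for which `P / C` has radical layering `S`. -/
def layerGrass (e : Fin n → Λ) (d : Fin n → ℕ) :
    Set (Gr K P (Module.finrank K P - ∑ i, d i)) :=
  {C | C ∈ moduleGrass K P e d ∧
    ∃ C' : Submodule Λ P, C'.restrictScalars K = C.1 ∧ HasRadicalLayering Λ (P ⧸ C') S}

/-- The dimensions `∂_i = (dim P - |d|) + ∑_{l = L + 1 - i}^{L} |dimension vector of S l|`. -/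
def flagDim (e : Fin n → Λ) (d : Fin n → ℕ) (i : Fin (L + 2)) : ℕ :=
  (Module.finrank K P - ∑ j, d j) +
    ∑ l ∈ Finset.univ.filter (fun l : Fin (L + 1) => L + 1 - (i : ℕ) ≤ (l : ℕ)),
      ∑ j, dimVec K e (S l) j

/-- The flags of `Λ`-submodules `D (L + 1) ⊆ ⋯ ⊆ D 0 = P` with `D l / D (l + 1) ≅ S l` for
`0 ≤ l ≤ L`. The flag variety lists a flag by increasing dimension, so that `D l` is its entry with
index `L + 1 - l`, the reverse of `l`. -/
def layerFlags (e : Fin n → Λ) (d : Fin n → ℕ) : Set (PartialFlag K P (flagDim K P S e d)) :=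
  {F | ∃ D : Fin (L + 2) → Submodule Λ P,
    (∀ l, (D l).restrictScalars K = (F.1 l.rev).1) ∧ D 0 = ⊤ ∧
    ∀ l : Fin (L + 1), Nonempty (subQuot (D l.castSucc) (D l.succ) ≃ₗ[Λ] S l)}

end Modules

end

/-!
The proof works with homogeneous coordinates of a naive kind: a subspace is given by a frame, and
an open or regular condition on subspaces is one on frames. The only semicontinuity that is needed
is that of the rank of a family of vectors (`IsPolyMap.isOpen_le_finrank_span`): the independent
families are the union of the sets where some matrix of linear forms has nonzero determinant.

*Closedness.* A semisimple module over a basic algebra is determined by its dimension vector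
(`nonempty_equiv_of_dimVec_eq`). So a flag of subspaces `D l` of the right dimensions has factors
`S l` if and only if each `D l` is stable under `Λ`, the radical maps `D l` into `D (l + 1)`, and the
dimension of each `e i D l` is at most what the `S m` prescribe; equality in the last condition
follows, since these dimensions sum to the dimension of `D l` (`mem_layerFlags_iff`). All these are
upper bounds on ranks, hence closed.

*Embedding.* Near a point `C`, choose `W l ⊆ J ^ l P` complementary to `C` in `C + J ^ l P`. For `C'`
in `GRASS(S)` near `C`, the space `C' + W l` has the same dimension as `C' + J ^ l P`, which contains
it, so that `Φ` is locally the map `C' ↦ (C' + W l)`; it is given on frames by appending fixed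
vectors (`isMorphismOn_sup`). A flag in `𝔘` satisfies `D (L + 1) + J ^ l P ⊆ D l`, and it lies in the
image of `Φ` when equality holds for all `l`. By a comparison of dimensions this is an open condition
(`mem_range_radFlag_iff`), so the image is open in `𝔘`. The inverse of `Φ` on the image is the
projection `D ↦ D (L + 1)`, because `J ^ (L + 1) = 0`.
-/

noncomputable section

/-! ### Spaces with functions -/

namespace KSpace

theorem isOpen_induced_iff {K X Y : Type*} {A : KSpace K X} {j : Y → X} {U : Set Y} :
    IsOpen[(A.induced j).top] U ↔ ∃ O, IsOpen[A.top] O ∧ j ⁻¹' O = U := Iff.rfl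

theorem isOpen_coinduced_iff {K X Y : Type*} {A : KSpace K Y} {π : Y → X} {U : Set X} :
    IsOpen[(A.coinduced π).top] U ↔ IsOpen[A.top] (π ⁻¹' U) := Iff.rfl

theorem IsMorphism.isOpen_preimage {K X Y : Type*} {A : KSpace K X} {B : KSpace K Y} {f : X → Y}
    (hf : IsMorphism A B f) {U : Set Y} (hU : IsOpen[B.top] U) : IsOpen[A.top] (f ⁻¹' U) :=
  @IsOpen.preimage X Y A.top B.top f hf.continuous U hU

/-- The regular functions of `A` form a sheaf: regularity depends only on the values on the open
set, and passes to smaller open sets and from an open cover to its union. -/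
structure IsSheaf {K X : Type*} (A : KSpace K X) : Prop where
  congr : ∀ {U : Set X} {f g : X → K}, A.RegularOn U f → (∀ x ∈ U, f x = g x) → A.RegularOn U g
  mono : ∀ {U O : Set X} {f : X → K}, A.RegularOn U f → IsOpen[A.top] O → O ⊆ U →
    A.RegularOn O f
  locality : ∀ {U : Set X} {f : X → K}, (∀ x ∈ U, ∃ O, IsOpen[A.top] O ∧ x ∈ O ∧
    A.RegularOn (U ∩ O) f) → A.RegularOn U f

theorem isSheaf_induced {K X Y : Type*} (j : Y → X) {A : KSpace K X} (hA : A.IsSheaf) :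
    (A.induced j).IsSheaf where
  congr := by
    intro U f g hf h y hy
    obtain ⟨O, hO, hyO, k, hk, hfk⟩ := hf y hy
    exact ⟨O, hO, hyO, k, hk, fun z hz hzO => by rw [← h z hz, hfk z hz hzO]⟩
  mono := by
    intro U O f hf _ hOU y hy
    obtain ⟨O', hO', hyO, k, hk, hfk⟩ := hf y (hOU hy)
    exact ⟨O', hO', hyO, k, hk, fun z hz hzO => hfk z (hOU hz) hzO⟩
  locality := by
    intro U f h y hy
    obtain ⟨N, hN, hyN, hf⟩ := h y hy
    obtain ⟨N', hN', rfl⟩ := isOpen_induced_iff.1 hN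
    obtain ⟨O, hO, hyO, k, hk, hfk⟩ := hf y ⟨hy, hyN⟩
    have hon : IsOpen[A.top] (O ∩ N') := @IsOpen.inter _ A.top _ _ hO hN'
    exact ⟨O ∩ N', hon, ⟨hyO, hyN⟩, k, hA.mono hk hon Set.inter_subset_left,
      fun z hz hzO => hfk z ⟨hz, hzO.2⟩ hzO.1⟩

theorem isSheaf_coinduced {K X Y : Type*} (π : Y → X) {A : KSpace K Y} (hA : A.IsSheaf) :
    (A.coinduced π).IsSheaf where
  congr := fun hf h => hA.congr hf fun x hx => h (π x) hx
  mono := fun hf hO hOU => hA.mono hf hO fun _ hx => hOU hx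
  locality := by
    intro U f h
    refine hA.locality fun y hy => ?_
    obtain ⟨O, hO, hyO, hf⟩ := h (π y) hy
    exact ⟨π ⁻¹' O, hO, hyO, hf⟩

theorem isSheaf_affine (K : Type*) [Field K] (W : Type*) [AddCommGroup W] [Module K W] :
    (affine K W).IsSheaf where
  congr := by
    intro U f g hf h x hx
    obtain ⟨p, hp, q, hq, hqx, hfq⟩ := hf x hx
    exact ⟨p, hp, q, hq, hqx, fun y hy hqy => by rw [← h y hy, hfq y hy hqy]⟩
  mono := by
    intro U O f hf _ hOU x hx
    obtain ⟨p, hp, q, hq, hqx, hfq⟩ := hf x (hOU hx)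
    exact ⟨p, hp, q, hq, hqx, fun y hy hqy => hfq y (hOU hy) hqy⟩
  locality := by
    intro U f h x hx
    obtain ⟨O, hO, hxO, hf⟩ := h x hx
    obtain ⟨p, hp, q, hq, hqx, hfq⟩ := hf x ⟨hx, hxO⟩
    -- Shrink `O` to a basic open set `r ≠ 0` around `x` and replace `p / q` by `(p * r) / (q * r)`.
    have hbasic : ∀ O : Set W, IsOpen[(affine K W).top] O → ∀ x ∈ O,
        ∃ r ∈ polyFun K W, r x ≠ 0 ∧ ∀ y, r y ≠ 0 → y ∈ O := by
      intro O hO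
      induction hO with
      | basic s hs =>
        obtain ⟨r, hr, rfl⟩ := hs
        exact fun x hx => ⟨r, hr, hx, fun _ h => h⟩
      | univ => exact fun x _ => ⟨1, one_mem _, by simp, fun _ _ => trivial⟩
      | inter s t _ _ hs ht =>
        intro x hx
        obtain ⟨r, hr, hrx, hrs⟩ := hs x hx.1
        obtain ⟨r', hr', hrx', hrs'⟩ := ht x hx.2
        refine ⟨r * r', mul_mem hr hr', by simp [hrx, hrx'], fun y hy => ?_⟩
        simp only [Pi.mul_apply, ne_eq, mul_eq_zero, not_or] at hy
        exact ⟨hrs y hy.1, hrs' y hy.2⟩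
      | sUnion S _ hS =>
        rintro x ⟨s, hs, hxs⟩
        obtain ⟨r, hr, hrx, hrs⟩ := hS s hs x hxs
        exact ⟨r, hr, hrx, fun y hy => ⟨s, hs, hrs y hy⟩⟩
    obtain ⟨r, hr, hrx, hrO⟩ := hbasic O hO x hxO
    refine ⟨p * r, mul_mem hp hr, q * r, mul_mem hq hr, by simp [hqx, hrx], fun y hy hqy => ?_⟩
    simp only [Pi.mul_apply, ne_eq, mul_eq_zero, not_or] at hqy
    rw [hfq y ⟨hy, hrO y hqy.2⟩ hqy.1, Pi.mul_apply, Pi.mul_apply, mul_div_mul_right _ _ hqy.2]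

/-- `F` restricts to a morphism from the open subset `O` of `A` to `B`. -/
structure IsMorphismOn {K X Y : Type*} (A : KSpace K X) (B : KSpace K Y) (O : Set X)
    (F : X → Y) : Prop where
  isOpen : IsOpen[A.top] O
  preimage : ∀ U : Set Y, IsOpen[B.top] U → IsOpen[A.top] (O ∩ F ⁻¹' U)
  comp : ∀ U : Set Y, IsOpen[B.top] U → ∀ g : Y → K, B.RegularOn U g →
    A.RegularOn (O ∩ F ⁻¹' U) (g ∘ F)

/-- A map on a subspace is a morphism if, around each point, it is the restriction of a morphism
defined on an open subset of the ambient space. -/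
theorem isMorphism_induced_of_locally {K X Y Z : Type*} {A : KSpace K X} {B : KSpace K Z}
    (j : Y → X) (f : Y → Z)
    (h : ∀ y, ∃ (O : Set X) (F : X → Z), j y ∈ O ∧ IsMorphismOn A B O F ∧
      ∀ z, j z ∈ O → f z = F (j z)) : IsMorphism (A.induced j) B f where
  continuous := by
    refine @Continuous.mk _ _ (A.induced j).top B.top f fun U hU => ?_
    refine (@isOpen_iff_forall_mem_open Y (A.induced j).top _).2 fun y hy => ?_
    obtain ⟨O, F, hyO, hF, hfF⟩ := h y
    refine ⟨j ⁻¹' (O ∩ F ⁻¹' U), fun z hz => ?_, isOpen_induced_iff.2 ⟨_, hF.preimage U hU, rfl⟩,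
      hyO, ?_⟩
    · simpa [hfF z hz.1] using hz.2
    · simpa [← hfF y hyO] using hy
  comp := by
    intro U hU g hg y hy
    obtain ⟨O, F, hyO, hF, hfF⟩ := h y
    refine ⟨O ∩ F ⁻¹' U, hF.preimage U hU, ⟨hyO, ?_⟩, g ∘ F, hF.comp U hU g hg,
      fun z _ hz => by simp [hfF z hz.1]⟩
    simpa [← hfF y hyO] using hy

/-- A map into a subspace is a morphism if it is one into the ambient space. -/
theorem isMorphism_to_induced {K X Y Z : Type*} {A : KSpace K X} (hA : A.IsSheaf)
    {B : KSpace K Z} {j : Y → Z} {f : X → Y} (h : IsMorphism A B (j ∘ f)) :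
    IsMorphism A (B.induced j) f where
  continuous := by
    let := A.top
    let := B.top
    exact continuous_induced_rng.2 h.continuous
  comp := by
    intro U hU g hg
    refine hA.locality fun x hx => ?_
    obtain ⟨O, hO, hxO, k, hk, hgk⟩ := hg (f x) hx
    have hO' : IsOpen[A.top] (j ∘ f ⁻¹' O) := h.isOpen_preimage hO
    have hU' : IsOpen[A.top] (f ⁻¹' U) := by
      obtain ⟨N, hN, rfl⟩ := isOpen_induced_iff.1 hU
      exact h.isOpen_preimage hN
    refine ⟨j ∘ f ⁻¹' O, hO', hxO, ?_⟩
    refine hA.congr (hA.mono (h.comp O hO k hk) (@IsOpen.inter _ A.top _ _ hU' hO')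
      Set.inter_subset_right) fun z hz => (hgk (f z) hz.1 hz.2).symm

theorem isMorphism_comp_induced {K X Y Z : Type*} {A : KSpace K X} {B : KSpace K Z} {f : X → Z}
    (hf : IsMorphism A B f) (j : Y → X) : IsMorphism (A.induced j) B (f ∘ j) where
  continuous := @Continuous.comp Y X Z (A.induced j).top A.top B.top j f hf.continuous
    (@continuous_induced_dom Y X j A.top)
  comp := fun U hU g hg _ hy => ⟨f ⁻¹' U, hf.isOpen_preimage hU, hy, g ∘ f,
    hf.comp U hU g hg, fun _ _ _ => rfl⟩

end KSpace

/-! ### Polynomial maps and semicontinuity of the rank -/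

/-- Polynomial maps between vector spaces: maps that pull polynomial functions back to polynomial
functions. -/
def IsPolyMap (K : Type*) [Field K] {E E' : Type*} [AddCommGroup E] [Module K E]
    [AddCommGroup E'] [Module K E'] (T : E → E') : Prop :=
  ∀ p ∈ polyFun K E', p ∘ T ∈ polyFun K E

section Poly

variable {K : Type*} [Field K] {E E' V : Type*} [AddCommGroup E] [Module K E]
  [AddCommGroup E'] [Module K E'] [AddCommGroup V] [Module K V]

theorem dual_mem_polyFun (φ : Module.Dual K E) : (φ : E → K) ∈ polyFun K E :=
  Algebra.subset_adjoin ⟨φ, rfl⟩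

theorem isPolyMap_of_dual {T : E → E'} (h : ∀ φ : Module.Dual K E', φ ∘ T ∈ polyFun K E) :
    IsPolyMap K T := by
  intro p hp
  induction hp using Algebra.adjoin_induction with
  | mem x hx => obtain ⟨φ, rfl⟩ := hx; exact h φ
  | algebraMap r => exact (polyFun K E).algebraMap_mem r
  | add x y _ _ hx hy => exact add_mem hx hy
  | mul x y _ _ hx hy => exact mul_mem hx hy

theorem LinearMap.isPolyMap (T : E →ₗ[K] E') : IsPolyMap K T :=
  isPolyMap_of_dual fun φ => dual_mem_polyFun (φ ∘ₗ T)

/-- A map into a power of `V` is polynomial if each component is linear or constant. -/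
theorem isPolyMap_pi {ι : Type*} [Finite ι] {T : E → ι → V}
    (h : ∀ i, (∃ A : E →ₗ[K] V, ∀ x, T x i = A x) ∨ ∃ w, ∀ x, T x i = w) : IsPolyMap K T := by
  classical
  have := Fintype.ofFinite ι
  refine isPolyMap_of_dual fun φ => ?_
  have hsum : φ ∘ T = ∑ i, fun x => φ (Pi.single i (T x i)) := by
    ext x
    simp only [Function.comp_apply, Finset.sum_apply]
    rw [← map_sum, Finset.univ_sum_single]
  rw [hsum]
  refine sum_mem fun i _ => ?_
  rcases h i with ⟨A, hA⟩ | ⟨w, hw⟩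
  · simp only [hA]
    exact dual_mem_polyFun (φ ∘ₗ LinearMap.single K (fun _ : ι => V) i ∘ₗ A)
  · simp only [hw]
    exact (polyFun K E).algebraMap_mem (φ (Pi.single i w))

/-- The same for a product of powers of `V`. -/
theorem isPolyMap_pi_pi {ι : Type*} [Finite ι] {κ : ι → Type*} [∀ i, Finite (κ i)]
    {T : E → ∀ i, κ i → V}
    (h : ∀ i a, (∃ A : E →ₗ[K] V, ∀ x, T x i a = A x) ∨ ∃ w, ∀ x, T x i a = w) :
    IsPolyMap K T := by
  have hT : IsPolyMap K fun x (s : Σ i, κ i) => T x s.1 s.2 :=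
    isPolyMap_pi fun s => h s.1 s.2
  let c : ((Σ i, κ i) → V) →ₗ[K] (∀ i, κ i → V) :=
    { toFun := fun y i a => y ⟨i, a⟩, map_add' := fun _ _ => rfl, map_smul' := fun _ _ => rfl }
  exact fun p hp => hT _ (c.isPolyMap p hp)

theorem IsPolyMap.isOpen_preimage {T : E → E'} (hT : IsPolyMap K T) {U : Set E'}
    (hU : IsOpen[(KSpace.affine K E').top] U) : IsOpen[(KSpace.affine K E).top] (T ⁻¹' U) := by
  have hc : Continuous[(KSpace.affine K E).top, (KSpace.affine K E').top] T := by
    let := (KSpace.affine K E).top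
    refine continuous_generateFrom_iff.2 ?_
    rintro _ ⟨p, hp, rfl⟩
    exact .basic _ ⟨p ∘ T, hT p hp, rfl⟩
  exact @IsOpen.preimage _ _ (_) (_) T hc U hU

theorem IsPolyMap.regularOn {T : E → E'} (hT : IsPolyMap K T) {U : Set E'} {g : E' → K}
    (hg : (KSpace.affine K E').RegularOn U g) :
    (KSpace.affine K E).RegularOn (T ⁻¹' U) (g ∘ T) := by
  intro x hx
  obtain ⟨p, hp, q, hq, hqx, hgq⟩ := hg (T x) hx
  exact ⟨p ∘ T, hT p hp, q ∘ T, hT q hq, hqx, fun y hy hqy => hgq (T y) hy hqy⟩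

theorem isOpen_linearIndependent (c : ℕ) :
    IsOpen[(KSpace.affine K (Fin c → V)).top] {v | LinearIndependent K v} := by
  have hset : {v : Fin c → V | LinearIndependent K v} =
      ⋃ ψ : Fin c → Module.Dual K V, {v | (Matrix.of fun a b => ψ a (v b)).det ≠ 0} := by
    ext v
    simp only [Set.mem_ofPred_eq, Set.mem_iUnion]
    constructor
    · intro hv
      -- The coordinates of a left inverse of the embedding `K ^ c → V` make the matrix the identity.
      obtain ⟨g, hg⟩ := (Fintype.linearCombination K v).exists_leftInverse_of_injective
        (LinearMap.ker_eq_bot.2 hv.fintypeLinearCombination_injective)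
      refine ⟨fun a => LinearMap.proj a ∘ₗ g, ?_⟩
      have h1 : (Matrix.of fun a b => (LinearMap.proj a ∘ₗ g) (v b)) = (1 : Matrix _ _ K) := by
        ext a b
        have := congrFun (LinearMap.congr_fun hg (Pi.single b 1)) a
        simpa [Fintype.linearCombination_apply_single, Matrix.one_apply, Pi.single_apply] using this
      rw [h1]; simp
    · rintro ⟨ψ, hψ⟩
      rw [Fintype.linearIndependent_iff]
      intro x hx
      have h0 : (Matrix.of fun a b => ψ a (v b)).mulVec x = 0 := by
        ext a
        have := congrArg (ψ a) hx
        simp only [map_sum, map_smul, smul_eq_mul, map_zero] at this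
        simpa [Matrix.mulVec, dotProduct, mul_comm] using this
      exact fun i => congrFun (Matrix.eq_zero_of_mulVec_eq_zero hψ h0) i
  rw [hset]
  refine @isOpen_iUnion _ _ (KSpace.affine K (Fin c → V)).top _ fun ψ => .basic _ ⟨_, ?_, rfl⟩
  have hdet : (fun v : Fin c → V => (Matrix.of fun a b => ψ a (v b)).det) =
      ∑ σ : Equiv.Perm (Fin c), (Equiv.Perm.sign σ : ℤ) •
        ∏ i, fun v : Fin c → V => ψ (σ i) (v i) := by
    ext v
    simp [Matrix.det_apply', Finset.sum_apply, Finset.prod_apply]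
  rw [hdet]
  exact sum_mem fun σ _ => zsmul_mem (prod_mem fun i _ =>
    dual_mem_polyFun (ψ (σ i) ∘ₗ (LinearMap.proj i : (Fin c → V) →ₗ[K] V))) _

theorem le_finrank_span_range_iff {ι : Type*} [Finite ι] (v : ι → V) (c : ℕ) :
    c ≤ Module.finrank K (Submodule.span K (Set.range v)) ↔
      ∃ a : Fin c → ι, LinearIndependent K (v ∘ a) := by
  constructor
  · intro h
    obtain ⟨κ, a, ha, hspan, hli⟩ := exists_linearIndependent' K v
    have := Finite.of_injective a ha
    have := Fintype.ofFinite κ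
    rw [← hspan, finrank_span_eq_card hli] at h
    obtain ⟨b⟩ : Nonempty (Fin c ↪ κ) := Function.Embedding.nonempty_of_card_le (by simpa using h)
    exact ⟨a ∘ b, hli.comp b b.injective⟩
  · rintro ⟨a, ha⟩
    have := Module.Finite.span_of_finite K (Set.finite_range v)
    have h1 := finrank_span_eq_card ha
    rw [Fintype.card_fin] at h1
    rw [← h1]
    exact Submodule.finrank_mono (Submodule.span_mono (Set.range_comp_subset_range a v))

/-- Lower semicontinuity of the rank. -/
theorem IsPolyMap.isOpen_le_finrank_span {ι : Type*} [Finite ι] {T : E → ι → V}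
    (hT : IsPolyMap K T) (c : ℕ) : IsOpen[(KSpace.affine K E).top]
      {x | c ≤ Module.finrank K (Submodule.span K (Set.range (T x)))} := by
  simp only [le_finrank_span_range_iff, Set.ofPred_exists]
  refine @isOpen_iUnion _ _ (KSpace.affine K E).top _ fun a => ?_
  exact IsPolyMap.isOpen_preimage (T := fun x => T x ∘ a) (fun p hp =>
    hT _ ((LinearMap.funLeft K V a).isPolyMap p hp)) (isOpen_linearIndependent c)

end Poly

/-! ### Quotients of subspaces of affine spaces

Both `grVariety` and `grProdVariety` are quotients, along a map `π`, of a subspace `j : X → E`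
of an affine space. -/

section FrameQuotient

variable {K : Type*} [Field K] {E E' V : Type*} [AddCommGroup E] [Module K E]
  [AddCommGroup E'] [Module K E'] [AddCommGroup V] [Module K V] {X X' Y Y' : Type*}

/-- If the subspace `D (π x)` is spanned by vectors that depend polynomially on `j x`, then its
dimension is lower semicontinuous. -/
theorem isOpen_le_finrank_of_lift (j : X → E) (π : X → Y) {ι : Type*} [Finite ι] (T : E → ι → V)
    (hT : IsPolyMap K T) (D : Y → Submodule K V)
    (hD : ∀ x, D (π x) = Submodule.span K (Set.range (T (j x)))) (c : ℕ) :
    IsOpen[(((KSpace.affine K E).induced j).coinduced π).top]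
      {y | c ≤ Module.finrank K (D y)} := by
  refine KSpace.isOpen_coinduced_iff.2 (KSpace.isOpen_induced_iff.2 ⟨_, hT.isOpen_le_finrank_span c, ?_⟩)
  ext x
  simp only [Set.mem_preimage, Set.mem_ofPred_eq]
  rw [hD]

/-- A map between such quotients is a morphism on an open set over which it lifts to a polynomial
map of the affine spaces. -/
theorem isMorphismOn_of_lift (j : X → E) (π : X → Y) (j' : X' → E') (π' : X' → Y') (T : E → E')
    (hT : IsPolyMap K T) {O : Set Y}
    (hO : IsOpen[(((KSpace.affine K E).induced j).coinduced π).top] O) (F : Y → Y')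
    (h : ∀ x, π x ∈ O → ∃ x', j' x' = T (j x) ∧ π' x' = F (π x)) :
    KSpace.IsMorphismOn (((KSpace.affine K E).induced j).coinduced π)
      (((KSpace.affine K E').induced j').coinduced π') O F where
  isOpen := hO
  preimage := by
    intro U hU
    obtain ⟨N, hN, hNU⟩ := KSpace.isOpen_induced_iff.1 (KSpace.isOpen_coinduced_iff.1 hU)
    obtain ⟨M, hM, hMO⟩ := KSpace.isOpen_induced_iff.1 (KSpace.isOpen_coinduced_iff.1 hO)
    refine KSpace.isOpen_coinduced_iff.2 (KSpace.isOpen_induced_iff.2 ⟨M ∩ T ⁻¹' N,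
      @IsOpen.inter _ (KSpace.affine K E).top _ _ hM (hT.isOpen_preimage hN), ?_⟩)
    ext x
    have h1 : j x ∈ M ↔ π x ∈ O := Set.ext_iff.1 hMO x
    simp only [Set.mem_preimage, Set.mem_inter_iff, h1]
    refine and_congr_right fun hx => ?_
    obtain ⟨x', hx', hxF⟩ := h x hx
    rw [← hx', ← hxF]
    exact Set.ext_iff.1 hNU x'
  comp := by
    intro U hU g hg x hx
    obtain ⟨x', hx', hxF⟩ := h x hx.1
    have hx'U : π' x' ∈ U := hxF ▸ hx.2
    obtain ⟨N, hN, hxN, k, hk, hgk⟩ := hg x' hx'U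
    refine ⟨T ⁻¹' N, hT.isOpen_preimage hN, by simpa [← hx'] using hxN, k ∘ T,
      hT.regularOn hk, fun z hz hzN => ?_⟩
    obtain ⟨z', hz', hzF⟩ := h z hz.1
    have := hgk z' (by simpa [hzF] using hz.2) (by simpa [hz'] using hzN)
    simpa [hzF, hz'] using this

end FrameQuotient

/-! ### Dimension vectors and semisimple modules over a basic algebra -/

section Modules

variable {K : Type*} [Field K] {Λ : Type*} [Ring Λ] [Algebra K Λ] {n : ℕ} {e : Fin n → Λ}
  {M N : Type*} [AddCommGroup M] [Module K M] [Module Λ M] [IsScalarTower K Λ M]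
  [AddCommGroup N] [Module K N] [Module Λ N] [IsScalarTower K Λ N]

theorem finiteDimensional_submodule [FiniteDimensional K M] (D : Submodule Λ M) :
    FiniteDimensional K D :=
  inferInstanceAs (FiniteDimensional K (D.restrictScalars K))

theorem finiteDimensional_quotient [FiniteDimensional K M] (D : Submodule Λ M) :
    FiniteDimensional K (M ⧸ D) :=
  Module.Finite.of_surjective (D.mkQ.restrictScalars K) D.mkQ_surjective

theorem dimVec_congr (f : M ≃ₗ[Λ] N) : dimVec K e M = dimVec K e N := by
  ext i
  have h : Submodule.map (f.restrictScalars K : M →ₗ[K] N)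
      (LinearMap.range (Algebra.lsmul K K M (e i))) =
      LinearMap.range (Algebra.lsmul K K N (e i)) := by
    ext y
    constructor
    · rintro ⟨_, ⟨x, rfl⟩, rfl⟩
      exact ⟨f x, by simp⟩
    · rintro ⟨x, rfl⟩
      exact ⟨_, ⟨f.symm x, rfl⟩, by simp⟩
  unfold dimVec
  rw [← h]
  exact (LinearEquiv.finrank_map_eq (f.restrictScalars K) _).symm

theorem dimVec_submodule (D : Submodule Λ M) (i : Fin n) :
    dimVec K e D i =
      Module.finrank K ((D.restrictScalars K).map (Algebra.lsmul K K M (e i))) := by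
  have h : (LinearMap.range (Algebra.lsmul K K D (e i))).map (D.subtype.restrictScalars K) =
      (D.restrictScalars K).map (Algebra.lsmul K K M (e i)) := by
    ext y
    constructor
    · rintro ⟨_, ⟨x, rfl⟩, rfl⟩
      exact ⟨x, x.2, by simp⟩
    · rintro ⟨x, hx, rfl⟩
      exact ⟨_, ⟨⟨x, hx⟩, rfl⟩, by simp⟩
  rw [← h]
  exact (Submodule.equivMapOfInjective (D.subtype.restrictScalars K) D.subtype_injective _).finrank_eq

/-- Additivity of the dimension vector on short exact sequences. -/
theorem dimVec_eq_add [FiniteDimensional K M] (he : OrthogonalIdempotents e)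
    (D : Submodule Λ M) : dimVec K e M = dimVec K e D + dimVec K e (M ⧸ D) := by
  ext i
  have := finiteDimensional_submodule (K := K) D
  set eM := LinearMap.range (Algebra.lsmul K K M (e i)) with heM
  let q : eM →ₗ[K] M ⧸ D := D.mkQ.restrictScalars K ∘ₗ eM.subtype
  have h1 := q.finrank_range_add_finrank_ker
  have hrange : LinearMap.range q = LinearMap.range (Algebra.lsmul K K (M ⧸ D) (e i)) := by
    ext y
    constructor
    · rintro ⟨⟨_, x, rfl⟩, rfl⟩
      exact ⟨D.mkQ x, by simp [q]⟩
    · rintro ⟨x, rfl⟩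
      obtain ⟨x, rfl⟩ := D.mkQ_surjective x
      exact ⟨⟨_, x, rfl⟩, by simp [q]⟩
  -- An element of `D` in `e i M` lies in `e i D`, because `e i` is idempotent.
  have hker : (LinearMap.ker q).map eM.subtype =
      (D.restrictScalars K).map (Algebra.lsmul K K M (e i)) := by
    ext y
    constructor
    · rintro ⟨⟨_, x, rfl⟩, hx, rfl⟩
      refine ⟨e i • x, ?_, ?_⟩
      · exact (Submodule.Quotient.mk_eq_zero D).1 hx
      · simp [← mul_smul, (he.idem i).eq]
    · rintro ⟨x, hx, rfl⟩
      refine ⟨⟨_, x, rfl⟩, ?_, rfl⟩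
      exact (Submodule.Quotient.mk_eq_zero D).2 (D.smul_mem (e i) hx)
  have h2 : Module.finrank K (LinearMap.ker q) = dimVec K e D i := by
    rw [dimVec_submodule, ← hker]
    exact (Submodule.equivMapOfInjective eM.subtype eM.subtype_injective _).finrank_eq
  rw [Pi.add_apply, ← h2]
  unfold dimVec
  rw [← hrange, add_comm]
  exact h1.symm

/-- The Peirce decomposition `M = ⨁ e i M`. -/
def peirceEquiv (he : CompleteOrthogonalIdempotents e) (M : Type*) [AddCommGroup M] [Module K M]
    [Module Λ M] [IsScalarTower K Λ M] :
    M ≃ₗ[K] ∀ i, LinearMap.range (Algebra.lsmul K K M (e i)) where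
  toFun m i := ⟨e i • m, m, rfl⟩
  map_add' x y := by ext i; simp
  map_smul' c x := by ext i; simp [smul_comm (e i) c x]
  invFun y := ∑ i, (y i : M)
  left_inv m := by simp [← Finset.sum_smul, he.complete]
  right_inv y := by
    ext i
    choose z hz using fun i => (y i).2
    simp only [← hz, Finset.smul_sum]
    rw [Finset.sum_eq_single i]
    · simp [← mul_smul, (he.idem i).eq]
    · intro j _ hj
      simp [← mul_smul, he.ortho hj.symm]
    · simp

theorem smul_peirce_coe (he : CompleteOrthogonalIdempotents e) (i : Fin n)
    (y : LinearMap.range (Algebra.lsmul K K M (e i))) : e i • (y : M) = y := by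
  obtain ⟨_, x, rfl⟩ := y
  simp [← mul_smul, (he.idem i).eq]

theorem sum_dimVec [FiniteDimensional K M] (he : CompleteOrthogonalIdempotents e) :
    ∑ i, dimVec K e M i = Module.finrank K M := by
  rw [(peirceEquiv (K := K) he M).finrank_eq, Module.finrank_pi_fintype]
  rfl

/-- Semisimple modules over a basic algebra are classified by their dimension vectors. -/
theorem nonempty_equiv_of_dimVec_eq (he : IsBasicAlgebra K e) [FiniteDimensional K M]
    [FiniteDimensional K N] (hM : ∀ x ∈ Ring.jacobson Λ, ∀ m : M, x • m = 0)
    (hN : ∀ x ∈ Ring.jacobson Λ, ∀ m : N, x • m = 0) (h : dimVec K e M = dimVec K e N) :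
    Nonempty (M ≃ₗ[Λ] N) := by
  obtain ⟨φ, -, hker, hφe⟩ := he.quotient
  -- Modulo the radical, `a` acts on `e i M` as the scalar `φ a i`, so that any family of linear
  -- isomorphisms `e i M ≃ e i N` is an isomorphism of modules.
  have key : ∀ (a : Λ) (i : Fin n), e i * a - φ a i • e i ∈ Ring.jacobson Λ ∧
      a * e i - φ a i • e i ∈ Ring.jacobson Λ := by
    intro a i
    constructor <;>
    · rw [← hker]
      ext j
      by_cases hj : j = i
      · subst hj; simp [hφe]
      · simp [hφe, hj]
  have hsmulM : ∀ (a : Λ) (i : Fin n) (m : M), e i • a • m = φ a i • e i • m := by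
    intro a i m
    have := hM _ (key a i).1 m
    rwa [sub_smul, mul_smul, smul_assoc, sub_eq_zero] at this
  have hsmulN : ∀ (a : Λ) (i : Fin n) (m : N), a • e i • m = φ a i • e i • m := by
    intro a i m
    have := hN _ (key a i).2 m
    rwa [sub_smul, mul_smul, smul_assoc, sub_eq_zero] at this
  let f : ∀ i, LinearMap.range (Algebra.lsmul K K M (e i)) ≃ₗ[K]
      LinearMap.range (Algebra.lsmul K K N (e i)) := fun i =>
    LinearEquiv.ofFinrankEq _ _ (congrFun h i)
  let T : M ≃ₗ[K] N := peirceEquiv he.complete M ≪≫ₗ LinearEquiv.piCongrRight f ≪≫ₗ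
    (peirceEquiv he.complete N).symm
  have hT : ∀ m, T m = ∑ i, (f i ⟨e i • m, m, rfl⟩ : N) := fun m => rfl
  refine ⟨{ T with map_smul' := fun a m => ?_ }⟩
  change T (a • m) = a • T m
  rw [hT, hT, Finset.smul_sum]
  refine Finset.sum_congr rfl fun i _ => ?_
  have h1 : (⟨e i • a • m, a • m, rfl⟩ : LinearMap.range (Algebra.lsmul K K M (e i))) =
      φ a i • ⟨e i • m, m, rfl⟩ := Subtype.ext (hsmulM a i m)
  rw [h1, map_smul, Submodule.coe_smul,
    ← smul_peirce_coe he.complete i (f i ⟨e i • m, m, rfl⟩), hsmulN]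

theorem smul_eq_zero_of_mem_jacobson [IsSemisimpleModule Λ N] {x : Λ}
    (hx : x ∈ Ring.jacobson Λ) (m : N) : x • m = 0 :=
  Module.mem_annihilator.1 (IsSemisimpleModule.jacobson_le_annihilator Λ N hx) m

end Modules

/-! ### Radical layers -/

section Layers

variable {Λ : Type*} [Ring Λ] {M N : Type*} [AddCommGroup M] [Module Λ M] [AddCommGroup N]
  [Module Λ N]

theorem nonempty_subQuot_comap_equiv {f : M →ₗ[Λ] N} (hf : Function.Surjective f)
    (A B : Submodule Λ N) :
    Nonempty (subQuot (A.comap f) (B.comap f) ≃ₗ[Λ] subQuot A B) := by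
  let g : A.comap f →ₗ[Λ] A := f.restrict fun _ hx => hx
  have hg : Function.Surjective g := fun ⟨y, hy⟩ => by
    obtain ⟨x, rfl⟩ := hf y
    exact ⟨⟨x, hy⟩, rfl⟩
  have hker : (B.comap f).submoduleOf (A.comap f) =
      LinearMap.ker ((B.submoduleOf A).mkQ ∘ₗ g) := by
    ext x
    exact (Submodule.Quotient.mk_eq_zero (B.submoduleOf A) (x := g x)).symm
  exact ⟨Submodule.quotEquivOfEq _ _ hker ≪≫ₗ
    LinearMap.quotKerEquivOfSurjective _ ((Submodule.mkQ_surjective _).comp hg)⟩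

theorem smul_mem_of_subQuot_equiv [IsSemisimpleModule Λ N] {A B : Submodule Λ M}
    (f : subQuot A B ≃ₗ[Λ] N) {x : Λ} (hx : x ∈ Ring.jacobson Λ) {a : M} (ha : a ∈ A) :
    x • a ∈ B := by
  have h : x • (B.submoduleOf A).mkQ ⟨a, ha⟩ = 0 :=
    f.injective (by rw [map_smul, smul_eq_zero_of_mem_jacobson hx, map_zero])
  rw [← map_smul, Submodule.mkQ_apply, Submodule.Quotient.mk_eq_zero] at h
  exact h

theorem subQuot_smul_eq_zero {A B : Submodule Λ M}
    (h : ∀ x ∈ Ring.jacobson Λ, ∀ a ∈ A, x • a ∈ B) (x : Λ) (hx : x ∈ Ring.jacobson Λ)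
    (m : subQuot A B) : x • m = 0 := by
  obtain ⟨a, rfl⟩ := Submodule.mkQ_surjective _ m
  rw [← map_smul, Submodule.mkQ_apply, Submodule.Quotient.mk_eq_zero]
  exact h x hx a a.2

theorem radPow_zero : radPow Λ M 0 = ⊤ := by
  rw [radPow, radIdeal, Submodule.pow_zero, Ideal.one_eq_top, Submodule.top_smul]

theorem radPow_succ (l : ℕ) : radPow Λ M (l + 1) = Ring.jacobson Λ • radPow Λ M l := by
  rw [radPow, radPow, radIdeal, radIdeal, ← Submodule.smul_assoc, smul_eq_mul, 
    Ideal.IsTwoSided.pow_succ]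

theorem radPow_quotient (C : Submodule Λ M) (l : ℕ) :
    radPow Λ (M ⧸ C) l = (radPow Λ M l).map C.mkQ := by
  rw [radPow, radPow, Submodule.map_smul'', Submodule.map_top, Submodule.range_mkQ]

theorem nonempty_subQuot_radPow_quotient_equiv (C : Submodule Λ M) (k l : ℕ) :
    Nonempty (subQuot (C ⊔ radPow Λ M k) (C ⊔ radPow Λ M l) ≃ₗ[Λ]
      subQuot (radPow Λ (M ⧸ C) k) (radPow Λ (M ⧸ C) l)) := by
  have h : ∀ k, C ⊔ radPow Λ M k = (radPow Λ (M ⧸ C) k).comap C.mkQ := fun k => by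
    rw [radPow_quotient, Submodule.comap_map_mkQ]
  rw [h, h]
  exact nonempty_subQuot_comap_equiv C.mkQ_surjective _ _

theorem radPow_antitone : Antitone (radPow Λ M) :=
  antitone_nat_of_succ_le fun l => by
    rw [radPow_succ]
    exact Submodule.smul_le_right

/-- If every step of a descending filtration is annihilated by the radical, then the filtration
contains the radical filtration. -/
theorem radPow_le_of_smul_mem {L : ℕ} {D : Fin (L + 2) → Submodule Λ M} (h0 : D 0 = ⊤)
    (h : ∀ l : Fin (L + 1), ∀ x ∈ Ring.jacobson Λ, ∀ a ∈ D l.castSucc, x • a ∈ D l.succ)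
    (l : Fin (L + 2)) : radPow Λ M l ≤ D l := by
  induction l using Fin.induction with
  | zero => simp [h0]
  | succ l ih =>
    rw [Fin.val_succ, radPow_succ]
    exact Submodule.smul_le.2 fun x hx a ha => h l x hx a (ih ha)

end Layers

/-! ### Semicontinuity and morphisms on Grassmannians -/

section Grassmannians

variable {K : Type*} [Field K] {V V' : Type*} [AddCommGroup V] [Module K V] [AddCommGroup V']
  [Module K V'] {ι : Type*} {k : ι → ℕ}

theorem KSpace.isSheaf_grVariety (m : ℕ) : (grVariety K V m).IsSheaf :=
  isSheaf_coinduced _ (isSheaf_induced _ (isSheaf_affine _ _))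

theorem KSpace.isSheaf_grProdVariety : (grProdVariety K V k).IsSheaf :=
  isSheaf_coinduced _ (isSheaf_induced _ (isSheaf_affine _ _))

theorem isOpen_le_finrank_map_sup_map [Finite ι] (i j : ι) (T T' : V →ₗ[K] V') (c : ℕ) :
    IsOpen[(grProdVariety K V k).top]
      {F | c ≤ Module.finrank K ↥((F i).1.map T ⊔ (F j).1.map T')} := by
  refine isOpen_le_finrank_of_lift _ _
    (fun (v : ∀ i, Fin (k i) → V) => Sum.elim (T ∘ v i) (T' ∘ v j)) (isPolyMap_pi ?_)
    (fun F : ∀ i, Gr K V (k i) => (F i).1.map T ⊔ (F j).1.map T') (fun v => ?_) c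
  · rintro (a | a)
    · exact .inl ⟨T ∘ₗ (LinearMap.proj a : (Fin (k i) → V) →ₗ[K] V) ∘ₗ LinearMap.proj i,
        fun _ => rfl⟩
    · exact .inl ⟨T' ∘ₗ (LinearMap.proj a : (Fin (k j) → V) →ₗ[K] V) ∘ₗ LinearMap.proj j,
        fun _ => rfl⟩
  · rw [Set.Sum.elim_range, Submodule.span_union, Set.range_comp, Set.range_comp,
      Submodule.span_image, Submodule.span_image]
    rfl

/-- `T (F i) ⊆ F j` means that `T (F i) + F j` has at most the dimension `k j` of `F j`. -/
theorem isClosed_map_le [Finite ι] [FiniteDimensional K V] (i j : ι) (T : V →ₗ[K] V) :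
    IsClosed[(grProdVariety K V k).top] {F | (F i).1.map T ≤ (F j).1} := by
  refine (@isOpen_compl_iff _ _ (grProdVariety K V k).top).1 ?_
  convert isOpen_le_finrank_map_sup_map (k := k) i j T LinearMap.id (k j + 1) using 1
  ext F
  simp only [Set.mem_compl_iff, Set.mem_ofPred_eq, Nat.succ_le_iff]
  rw [Submodule.map_id]
  have hj : Module.finrank K (F j).1 = k j := (F j).2
  rw [← sup_eq_right]
  constructor
  · intro h
    have := Submodule.finrank_lt_finrank_of_lt (lt_of_le_of_ne
      (le_sup_right : (F j).1 ≤ (F i).1.map T ⊔ (F j).1) (Ne.symm h))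
    rwa [hj] at this
  · intro h h'
    rw [h', hj] at h
    exact lt_irrefl _ h

theorem isClosed_finrank_map_le [Finite ι] (i : ι) (T : V →ₗ[K] V') (c : ℕ) :
    IsClosed[(grProdVariety K V k).top] {F | Module.finrank K ((F i).1.map T) ≤ c} := by
  refine (@isOpen_compl_iff _ _ (grProdVariety K V k).top).1 ?_
  convert isOpen_le_finrank_map_sup_map (k := k) i i T 0 (c + 1) using 1
  ext F
  simp only [Set.mem_compl_iff, Set.mem_ofPred_eq, Nat.succ_le_iff, not_le]
  rw [Submodule.map_zero, sup_bot_eq]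

theorem exists_span_range_eq [FiniteDimensional K V] (W : Submodule K V) :
    ∃ w : Fin (Module.finrank K W) → V, Submodule.span K (Set.range w) = W := by
  refine ⟨W.subtype ∘ Module.finBasis K W, ?_⟩
  rw [Set.range_comp, Submodule.span_image, (Module.finBasis K W).span_eq, Submodule.map_top,
    Submodule.range_subtype]

theorem isOpen_le_finrank_sup [Finite ι] [FiniteDimensional K V] (i : ι) (W : Submodule K V)
    (c : ℕ) : IsOpen[(grProdVariety K V k).top] {F | c ≤ Module.finrank K ↥((F i).1 ⊔ W)} := by
  obtain ⟨w, hw⟩ := exists_span_range_eq W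
  refine isOpen_le_finrank_of_lift _ _
    (fun (v : ∀ i, Fin (k i) → V) => Sum.elim (v i) w) (isPolyMap_pi ?_)
    (fun F : ∀ i, Gr K V (k i) => (F i).1 ⊔ W) (fun v => ?_) c
  · rintro (a | a)
    · exact .inl ⟨(LinearMap.proj a : (Fin (k i) → V) →ₗ[K] V) ∘ₗ LinearMap.proj i,
        fun _ => rfl⟩
    · exact .inr ⟨w a, fun _ => rfl⟩
  · rw [Set.Sum.elim_range, Submodule.span_union, hw]
    rfl

theorem isOpen_gr_le_finrank_sup [FiniteDimensional K V] (m : ℕ) (W : Submodule K V)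
    (c : ℕ) : IsOpen[(grVariety K V m).top] {C | c ≤ Module.finrank K ↥(C.1 ⊔ W)} := by
  obtain ⟨w, hw⟩ := exists_span_range_eq W
  refine isOpen_le_finrank_of_lift _ _
    (fun (v : Fin m → V) => Sum.elim v w) (isPolyMap_pi ?_)
    (fun C : Gr K V m => C.1 ⊔ W) (fun v => ?_) c
  · rintro (a | a)
    · exact .inl ⟨LinearMap.proj a, fun _ => rfl⟩
    · exact .inr ⟨w a, fun _ => rfl⟩
  · rw [Set.Sum.elim_range, Submodule.span_union, hw]
    rfl

/-- Adding fixed subspaces `W i` is a morphism on the open set of subspaces that meet each `W i`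
trivially: it lifts to frames by appending a basis of `W i`. -/
theorem isMorphismOn_sup [Finite ι] [FiniteDimensional K V] {m : ℕ} (W : ι → Submodule K V)
    (hk : ∀ i, k i = m + Module.finrank K (W i)) (F : Gr K V m → ∀ i, Gr K V (k i))
    (hF : ∀ C : Gr K V m, (∀ i, k i ≤ Module.finrank K ↥(C.1 ⊔ W i)) →
      ∀ i, (F C i).1 = C.1 ⊔ W i) :
    KSpace.IsMorphismOn (grVariety K V m) (grProdVariety K V k)
      {C | ∀ i, k i ≤ Module.finrank K ↥(C.1 ⊔ W i)} F := by
  choose w hw using fun i => exists_span_range_eq (W i)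
  let ε : ∀ i, Fin (k i) ≃ Fin m ⊕ Fin (Module.finrank K (W i)) := fun i =>
    (finCongr (hk i)).trans finSumFinEquiv.symm
  have hopen : IsOpen[(grVariety K V m).top]
      {C | ∀ i, k i ≤ Module.finrank K ↥(C.1 ⊔ W i)} := by
    simp only [Set.ofPred_forall]
    let := (grVariety K V m).top
    exact isOpen_iInter_of_finite fun i => isOpen_gr_le_finrank_sup m (W i) (k i)
  refine isMorphismOn_of_lift _ _ _ _ (fun (v : Fin m → V) i a => Sum.elim v (w i) (ε i a))
    (isPolyMap_pi_pi fun i a => ?_) hopen F fun v hv => ?_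
  · rcases h : ε i a with b | b
    · exact .inl ⟨LinearMap.proj b, fun x => by simp⟩
    · exact .inr ⟨w i b, fun x => by simp⟩
  · have hspan : ∀ i, Submodule.span K (Set.range fun a => Sum.elim v.1 (w i) (ε i a)) =
        v.span.1 ⊔ W i := fun i => by
      rw [show (fun a => Sum.elim v.1 (w i) (ε i a)) = Sum.elim v.1 (w i) ∘ ε i from rfl,
        (ε i).surjective.range_comp, Set.Sum.elim_range, Submodule.span_union, hw]
      rfl
    refine ⟨fun i => ⟨fun a => Sum.elim v.1 (w i) (ε i a), ?_⟩, rfl, ?_⟩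
    · rw [linearIndependent_iff_card_le_finrank_span, Set.finrank, hspan, Fintype.card_fin]
      exact hv i
    · funext i
      exact Subtype.ext ((hspan i).trans (hF _ hv i).symm)

/-- The projection to a factor; `m` is kept apart from `k i` because equal dimensions need not be
definitionally equal. -/
theorem isMorphism_proj (i : ι) {m : ℕ} (h : k i = m) :
    KSpace.IsMorphism (grProdVariety K V k) (grVariety K V m)
      (fun F => ⟨(F i).1, (F i).2.trans h⟩) := by
  subst h
  have hF := isMorphismOn_of_lift (K := K) (fun (v : ∀ i, Frame K V (k i)) i => (v i).1)
    (fun v i => (v i).span) (fun v : Frame K V (k i) => v.1) Frame.span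
    (fun v : ∀ i, Fin (k i) → V => v i)
    (LinearMap.isPolyMap (LinearMap.proj i : (∀ i, Fin (k i) → V) →ₗ[K] _))
    (O := Set.univ) (@isOpen_univ _ (grProdVariety K V k).top) (fun F => F i)
    fun v _ => ⟨v i, rfl, rfl⟩
  refine @KSpace.IsMorphism.mk _ _ _ (grProdVariety K V k) (grVariety K V (k i)) _
    (@Continuous.mk _ _ (_) (_) _ fun U hU => ?_) fun U hU g hg => ?_
  · have := hF.preimage U hU
    rwa [Set.univ_inter] at this
  · have := hF.comp U hU g hg
    rwa [Set.univ_inter] at this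

end Grassmannians

/-! ### Flags of submodules with prescribed semisimple factors -/

section LayerFlags

theorem filter_castSucc_lt_succ {L : ℕ} (l : Fin (L + 1)) :
    (Finset.univ.filter fun m : Fin (L + 1) => m.castSucc < l.succ) =
      insert l (Finset.univ.filter fun m : Fin (L + 1) => m.castSucc < l.castSucc) := by
  ext m
  simp only [Finset.mem_filter, Finset.mem_insert, Finset.mem_univ, true_and, Fin.lt_def,
    Fin.ext_iff, Fin.val_castSucc, Fin.val_succ]
  omega

variable {K : Type*} [Field K] {Λ : Type*} [Ring Λ] [Algebra K Λ] {n : ℕ} {e : Fin n → Λ}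
  {P : Type*} [AddCommGroup P] [Module K P] {L : ℕ} {S : Fin (L + 1) → Type*}
  [∀ l, AddCommGroup (S l)] [∀ l, Module K (S l)] [∀ l, Module Λ (S l)]
  [∀ l, IsScalarTower K Λ (S l)] {d : Fin n → ℕ}

/-- The dimension of the member with index `l` of a flag, without truncated subtraction. -/
theorem flagDim_rev_add (hd : ∑ l, dimVec K e (S l) = d) (hdP : ∑ i, d i ≤ Module.finrank K P)
    (l : Fin (L + 2)) : flagDim K P S e d l.rev +
      ∑ m with m.castSucc < l, ∑ j, dimVec K e (S m) j = Module.finrank K P := by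
  have h1 : ∑ i, d i = ∑ m, ∑ j, dimVec K e (S m) j := by
    rw [← hd, Finset.sum_comm]
    simp
  have h2 := Finset.sum_filter_add_sum_filter_not Finset.univ
    (fun m : Fin (L + 1) => m.castSucc < l) fun m => ∑ j, dimVec K e (S m) j
  have h3 : (Finset.univ.filter fun m : Fin (L + 1) => L + 1 - (l.rev : ℕ) ≤ (m : ℕ)) =
      Finset.univ.filter fun m : Fin (L + 1) => ¬ m.castSucc < l := by
    ext m
    simp only [Finset.mem_filter, Finset.mem_univ, true_and, Fin.lt_def, Fin.val_castSucc,
      Fin.val_rev]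
    omega
  unfold flagDim
  rw [h3]
  omega

theorem flagDim_rev_last (hd : ∑ l, dimVec K e (S l) = d)
    (hdP : ∑ i, d i ≤ Module.finrank K P) :
    flagDim K P S e d (Fin.last (L + 1)).rev = Module.finrank K P - ∑ i, d i := by
  have h := flagDim_rev_add hd hdP (Fin.last (L + 1))
  simp only [Fin.castSucc_lt_last, Finset.filter_true] at h
  rw [Finset.sum_comm] at h
  have h2 : ∑ i, d i = ∑ i, ∑ l, dimVec K e (S l) i := by simp [← hd]
  omega

variable [Module Λ P] [IsScalarTower K Λ P]

theorem exists_restrictScalars_eq {E : Submodule K P}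
    (h : ∀ x : Λ, E.map (Algebra.lsmul K K P x) ≤ E) :
    ∃ D : Submodule Λ P, D.restrictScalars K = E :=
  ⟨{ E with smul_mem' := fun x _ ha => h x ⟨_, ha, rfl⟩ }, rfl⟩

variable [FiniteDimensional K P]

theorem dimVec_eq_add_subQuot (he : OrthogonalIdempotents e) {A B : Submodule Λ P} (h : B ≤ A) :
    dimVec K e A = dimVec K e B + dimVec K e (subQuot A B) := by
  have := finiteDimensional_submodule (K := K) A
  rw [dimVec_eq_add he (B.submoduleOf A), dimVec_congr (Submodule.submoduleOfEquivOfLe h)]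

/-- The dimension vectors in a filtration of `P` whose successive factors have the same dimension
vectors as the `S l`. -/
theorem dimVec_filtration (he : OrthogonalIdempotents e) {D : Fin (L + 2) → Submodule Λ P}
    (h0 : D 0 = ⊤) (hle : ∀ l : Fin (L + 1), D l.succ ≤ D l.castSucc)
    (hS : ∀ l : Fin (L + 1), dimVec K e (subQuot (D l.castSucc) (D l.succ)) = dimVec K e (S l))
    (l : Fin (L + 2)) :
    dimVec K e (D l) + ∑ m with m.castSucc < l, dimVec K e (S m) = dimVec K e P := by
  induction l using Fin.induction with
  | zero =>
    rw [h0, dimVec_congr Submodule.topEquiv]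
    simp
  | succ l ih =>
    rw [filter_castSucc_lt_succ, Finset.sum_insert (by simp), ← hS l, ← add_assoc,
      ← dimVec_eq_add_subQuot he (hle l), ih]

theorem finrank_filtration (he : CompleteOrthogonalIdempotents e)
    (hd : ∑ l, dimVec K e (S l) = d) (hdP : ∑ i, d i ≤ Module.finrank K P)
    {D : Submodule Λ P} {l : Fin (L + 2)}
    (h : dimVec K e D + ∑ m with m.castSucc < l, dimVec K e (S m) = dimVec K e P) :
    Module.finrank K D = flagDim K P S e d l.rev := by
  have := finiteDimensional_submodule (K := K) D
  have h1 := flagDim_rev_add (P := P) hd hdP l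
  have h2 := congrArg (fun v : Fin n → ℕ => ∑ i, v i) h
  simp only [Pi.add_apply, Finset.sum_add_distrib, sum_dimVec he, Finset.sum_apply] at h2
  rw [Finset.sum_comm] at h2
  omega

/-- Closed conditions that cut out the flags of submodules with factors `S l`: the last one bounds
the dimension of `e i D`, and since these dimensions add up to that of `D`, it prescribes them. -/
theorem mem_layerFlags_iff [∀ l, FiniteDimensional K (S l)] [∀ l, IsSemisimpleModule Λ (S l)]
    (he : IsBasicAlgebra K e) (hd : ∑ l, dimVec K e (S l) = d) (hdP : d ≤ dimVec K e P)
    (F : PartialFlag K P (flagDim K P S e d)) :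
    F ∈ layerFlags K P S e d ↔
      (∀ (l : Fin (L + 2)) (x : Λ),
        (F.1 l.rev).1.map (Algebra.lsmul K K P x) ≤ (F.1 l.rev).1) ∧
      (∀ (l : Fin (L + 1)), ∀ x ∈ Ring.jacobson Λ,
        (F.1 l.castSucc.rev).1.map (Algebra.lsmul K K P x) ≤ (F.1 l.succ.rev).1) ∧
      ∀ (l : Fin (L + 2)) (i : Fin n),
        Module.finrank K ((F.1 l.rev).1.map (Algebra.lsmul K K P (e i))) ≤
          dimVec K e P i - ∑ m with m.castSucc < l, dimVec K e (S m) i := by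
  have hle : ∀ {D : Fin (L + 2) → Submodule Λ P}, (∀ l, (D l).restrictScalars K = (F.1 l.rev).1) →
      ∀ l : Fin (L + 1), D l.succ ≤ D l.castSucc := by
    intro D hD l x hx
    have := F.2 l.succ.rev l.castSucc.rev (Fin.rev_le_rev.2 l.castSucc_lt_succ.le)
    rw [← hD, ← hD] at this
    exact this hx
  constructor
  · rintro ⟨D, hD, h0, hS⟩
    refine ⟨fun l x => ?_, fun l x hx => ?_, fun l i => ?_⟩
    · rw [← hD]
      rintro _ ⟨a, ha, rfl⟩
      exact (D l).smul_mem x ha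
    · rw [← hD, ← hD]
      rintro _ ⟨a, ha, rfl⟩
      exact smul_mem_of_subQuot_equiv (hS l).some hx ha
    · rw [← hD, ← dimVec_submodule]
      have := congrFun (dimVec_filtration he.complete.toOrthogonalIdempotents h0 (hle hD)
        (fun l => dimVec_congr (K := K) (hS l).some) l) i
      simp only [Pi.add_apply, Finset.sum_apply] at this
      omega
  · rintro ⟨hmod, hJ, hdim⟩
    choose D hD using fun l => exists_restrictScalars_eq (hmod l)
    have hdP' : ∑ i, d i ≤ Module.finrank K P := by
      rw [← sum_dimVec he.complete]
      exact Finset.sum_le_sum fun i _ => hdP i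
    have hsum : ∀ (l : Fin (L + 2)) i, ∑ m with m.castSucc < l, dimVec K e (S m) i ≤
        dimVec K e P i := fun l i => by
      refine le_trans ?_ (hdP i)
      rw [← hd, Finset.sum_apply]
      exact Finset.sum_le_sum_of_subset (Finset.filter_subset _ _)
    have hdimD : ∀ l, dimVec K e (D l) + ∑ m with m.castSucc < l, dimVec K e (S m) =
        dimVec K e P := by
      intro l
      have := finiteDimensional_submodule (K := K) (D l)
      have hle' : ∀ i ∈ Finset.univ, (dimVec K e (D l) +
          ∑ m with m.castSucc < l, dimVec K e (S m)) i ≤ dimVec K e P i := by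
        intro i _
        have h1 := hdim l i
        rw [← hD, ← dimVec_submodule] at h1
        have h2 := hsum l i
        rw [Pi.add_apply, Finset.sum_apply]
        omega
      refine funext fun i => (Finset.sum_eq_sum_iff_of_le hle').1 ?_ i (Finset.mem_univ i)
      have h1 := flagDim_rev_add (P := P) hd hdP' l
      have h2 : Module.finrank K (D l) = flagDim K P S e d l.rev := by
        rw [← (F.1 l.rev).2, ← hD]
        rfl
      simp only [Pi.add_apply, Finset.sum_apply, Finset.sum_add_distrib, sum_dimVec he.complete]
      rw [Finset.sum_comm, h2, h1]
    refine ⟨D, hD, ?_, fun l => ?_⟩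
    · have h1 := finrank_filtration he.complete hd hdP' (hdimD 0)
      have h2 := flagDim_rev_add (P := P) hd hdP' 0
      simp only [Fin.not_lt_zero, Finset.filter_false, Finset.sum_empty, add_zero] at h2
      have h3 : (D 0).restrictScalars K = ⊤ :=
        Submodule.eq_top_of_finrank_eq (h1.trans h2)
      exact (Submodule.restrictScalars_eq_top_iff K Λ P).1 h3
    · have := finiteDimensional_submodule (K := K) (D l.castSucc)
      have := finiteDimensional_quotient (K := K) ((D l.succ).submoduleOf (D l.castSucc))
      refine nonempty_equiv_of_dimVec_eq he (subQuot_smul_eq_zero fun x hx a ha => ?_)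
        (fun x hx => smul_eq_zero_of_mem_jacobson hx) ?_
      · have h1 := hJ l x hx
        rw [← hD, ← hD] at h1
        exact h1 ⟨a, ha, rfl⟩
      · have h1 := hdimD l.castSucc
        have h2 := hdimD l.succ
        rw [filter_castSucc_lt_succ, Finset.sum_insert (by simp), ← add_assoc] at h2
        rw [dimVec_eq_add_subQuot he.complete.toOrthogonalIdempotents (hle hD l)] at h1
        exact add_left_cancel (add_right_cancel (h1.trans h2.symm))

theorem isClosed_layerFlags [∀ l, FiniteDimensional K (S l)] [∀ l, IsSemisimpleModule Λ (S l)]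
    (he : IsBasicAlgebra K e) (hd : ∑ l, dimVec K e (S l) = d) (hdP : d ≤ dimVec K e P) :
    IsClosed[(flagVariety K P (flagDim K P S e d)).top] (layerFlags K P S e d) := by
  have hset : layerFlags K P S e d = Subtype.val ⁻¹'
      ((⋂ (l : Fin (L + 2)) (x : Λ), {F : ∀ i, Gr K P (flagDim K P S e d i) |
        (F l.rev).1.map (Algebra.lsmul K K P x) ≤ (F l.rev).1}) ∩
      ((⋂ (l : Fin (L + 1)) (x ∈ Ring.jacobson Λ), {F : ∀ i, Gr K P (flagDim K P S e d i) |
        (F l.castSucc.rev).1.map (Algebra.lsmul K K P x) ≤ (F l.succ.rev).1}) ∩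
      ⋂ (l : Fin (L + 2)) (i : Fin n), {F : ∀ i, Gr K P (flagDim K P S e d i) |
        Module.finrank K ((F l.rev).1.map (Algebra.lsmul K K P (e i))) ≤
          dimVec K e P i - ∑ m with m.castSucc < l, dimVec K e (S m) i})) := by
    ext F
    rw [mem_layerFlags_iff he hd hdP]
    simp only [Set.mem_preimage, Set.mem_inter_iff, Set.mem_iInter, Set.mem_ofPred_eq]
  rw [hset]
  let := (grProdVariety K P (flagDim K P S e d)).top
  refine IsClosed.preimage continuous_induced_dom ?_
  exact (isClosed_iInter fun l => isClosed_iInter fun x => isClosed_map_le _ _ _).inter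
    ((isClosed_iInter fun l => isClosed_iInter fun x => isClosed_iInter fun _ =>
      isClosed_map_le _ _ _).inter
    (isClosed_iInter fun l => isClosed_iInter fun i => isClosed_finrank_map_le _ _ _))

end LayerFlags

/-! ### The flag of a submodule and the radical filtration -/

section RadicalFlag

theorem exists_le_inf_eq_bot_and_sup_eq {K V : Type*} [Field K] [AddCommGroup V] [Module K V]
    (C J : Submodule K V) : ∃ W ≤ J, C ⊓ W = ⊥ ∧ C ⊔ W = C ⊔ J := by
  obtain ⟨W, hdisj, hW⟩ := IsModularLattice.exists_disjoint_and_sup_eq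
    (inf_le_right : C ⊓ J ≤ J)
  have hWJ : W ≤ J := le_sup_right.trans hW.le
  refine ⟨W, hWJ, ?_, ?_⟩
  · rw [← hdisj.eq_bot, inf_assoc, inf_eq_right.2 hWJ]
  · calc C ⊔ W = C ⊔ C ⊓ J ⊔ W := by rw [sup_inf_self]
      _ = C ⊔ J := by rw [sup_assoc, hW]

variable {K : Type*} [Field K] {Λ : Type*} [Ring Λ] [Algebra K Λ] {n : ℕ} {e : Fin n → Λ}
  {P : Type*} [AddCommGroup P] [Module K P] [Module Λ P] [IsScalarTower K Λ P]
  [FiniteDimensional K P] {L : ℕ} {S : Fin (L + 1) → Type*}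
  [∀ l, AddCommGroup (S l)] [∀ l, Module K (S l)] [∀ l, Module Λ (S l)]
  [∀ l, IsScalarTower K Λ (S l)] {d : Fin n → ℕ}

theorem finrank_sup_radPow (he : CompleteOrthogonalIdempotents e)
    (hd : ∑ l, dimVec K e (S l) = d) (hdP : ∑ i, d i ≤ Module.finrank K P) {C : Submodule Λ P}
    (hC : HasRadicalLayering Λ (P ⧸ C) S) (l : Fin (L + 2)) :
    Module.finrank K ↥(C ⊔ radPow Λ P l) = flagDim K P S e d l.rev := by
  refine finrank_filtration (D := C ⊔ radPow Λ P l) he hd hdP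
    (dimVec_filtration he.toOrthogonalIdempotents (D := fun l => C ⊔ radPow Λ P l)
      (by simp [radPow_zero]) (fun l => sup_le_sup_left (radPow_antitone (by simp)) C)
      (fun l => ?_) l)
  obtain ⟨f⟩ := nonempty_subQuot_radPow_quotient_equiv C l (l + 1)
  exact dimVec_congr (f ≪≫ₗ (hC l).some)

/-- The flag of the submodules `C + J ^ l P`. -/
def radFlag (he : CompleteOrthogonalIdempotents e)
    (hd : ∑ l, dimVec K e (S l) = d) (hdP : ∑ i, d i ≤ Module.finrank K P)
    (C : layerGrass K P S e d) : layerFlags K P S e d :=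
  ⟨⟨fun i => ⟨C.1.1 ⊔ (radPow Λ P i.rev).restrictScalars K, by
      obtain ⟨C', hC', hlay⟩ := C.2.2
      have h := finrank_sup_radPow he hd hdP hlay i.rev
      rw [Fin.rev_rev] at h
      rw [← hC', ← h]
      exact congrArg (fun D : Submodule K P => Module.finrank K D)
        (Submodule.restrictScalars_sup ..).symm⟩,
    fun i j hij => sup_le_sup_left (fun _ hx => radPow_antitone
      (Fin.rev_le_rev.2 hij : (j.rev : Fin (L + 2)) ≤ i.rev) hx) _⟩, by
    obtain ⟨C', hC', hlay⟩ := C.2.2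
    refine ⟨fun l => C' ⊔ radPow Λ P l, fun l => ?_, by simp [radPow_zero], fun l => ?_⟩
    · simp only [Fin.rev_rev, ← hC']
      exact Submodule.restrictScalars_sup ..
    · obtain ⟨f⟩ := nonempty_subQuot_radPow_quotient_equiv C' l (l + 1)
      exact ⟨f ≪≫ₗ (hlay l).some⟩⟩

variable (he : CompleteOrthogonalIdempotents e)
    (hd : ∑ l, dimVec K e (S l) = d) (hdP : ∑ i, d i ≤ Module.finrank K P)

theorem radFlag_apply (C : layerGrass K P S e d) (l : Fin (L + 2)) :
    ((radFlag he hd hdP C).1.1 l.rev).1 = C.1.1 ⊔ (radPow Λ P l).restrictScalars K := by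
  change C.1.1 ⊔ (radPow Λ P l.rev.rev).restrictScalars K = _
  rw [Fin.rev_rev]

theorem radFlag_last (hL : radIdeal Λ (L + 1) = ⊥) (C : layerGrass K P S e d) :
    ((radFlag he hd hdP C).1.1 (Fin.last (L + 1)).rev).1 = C.1.1 := by
  rw [radFlag_apply, radPow, Fin.val_last, hL, Submodule.bot_smul]
  simp

theorem radFlag_injective (hL : radIdeal Λ (L + 1) = ⊥) :
    Function.Injective (radFlag (P := P) he hd hdP) := fun C C' h => by
  refine Subtype.ext (Subtype.ext ?_)
  rw [← radFlag_last he hd hdP hL C, h, radFlag_last he hd hdP hL C']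

/-- A flag in `layerFlags` contains the flag of the `D (L + 1) + J ^ l P`; so it comes from a point
of `layerGrass` as soon as the dimensions of the latter are not too small. -/
theorem mem_range_radFlag_iff (hL : radIdeal Λ (L + 1) = ⊥)
    [∀ l, IsSemisimpleModule Λ (S l)] (F : layerFlags K P S e d) :
    F ∈ Set.range (radFlag he hd hdP) ↔ ∀ l : Fin (L + 2), flagDim K P S e d l.rev ≤
      Module.finrank K
        ↥((F.1.1 (Fin.last (L + 1)).rev).1 ⊔ (radPow Λ P l).restrictScalars K) := by
  constructor
  · rintro ⟨C, rfl⟩ l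
    rw [radFlag_last he hd hdP hL, ← radFlag_apply he hd hdP,
      ((radFlag he hd hdP C).1.1 l.rev).2]
  · intro h
    obtain ⟨D, hD, h0, hS⟩ := F.2
    have hJ := radPow_le_of_smul_mem h0 fun l x hx a ha =>
      smul_mem_of_subQuot_equiv (hS l).some hx ha
    have hsup : ∀ l : Fin (L + 2), D (Fin.last (L + 1)) ⊔ radPow Λ P l = D l := by
      intro l
      have h1 : (D (Fin.last (L + 1)) ⊔ radPow Λ P l).restrictScalars K =
          (F.1.1 l.rev).1 := by
        rw [Submodule.restrictScalars_sup, hD]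
        refine Submodule.eq_of_le_of_finrank_le (sup_le ?_ ?_) ?_
        · exact F.1.2 _ _ (Fin.rev_le_rev.2 (Fin.le_last l))
        · rw [← hD]
          exact fun _ hx => hJ l hx
        · rw [(F.1.1 l.rev).2]
          exact h l
      exact Submodule.restrictScalars_injective K Λ P (h1.trans (hD l).symm)
    have hlay : HasRadicalLayering Λ (P ⧸ D (Fin.last (L + 1))) S := by
      intro l
      obtain ⟨f⟩ := nonempty_subQuot_radPow_quotient_equiv (D (Fin.last (L + 1))) l (l + 1)
      have h1 := hsup l.castSucc
      have h2 := hsup l.succ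
      rw [Fin.val_castSucc] at h1
      rw [Fin.val_succ] at h2
      rw [h1, h2] at f
      exact ⟨f.symm ≪≫ₗ (hS l).some⟩
    have hle : ∀ l : Fin (L + 1), D l.succ ≤ D l.castSucc := fun l => by
      rw [← hsup l.succ, ← hsup l.castSucc]
      exact sup_le_sup_left (radPow_antitone (by simp)) _
    have hdim : dimVec K e (P ⧸ D (Fin.last (L + 1))) = d := by
      have h1 := dimVec_filtration he.toOrthogonalIdempotents h0 hle
        (fun l => dimVec_congr (K := K) (hS l).some) (Fin.last (L + 1))
      simp only [Fin.castSucc_lt_last, Finset.filter_true, hd] at h1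
      rw [dimVec_eq_add he.toOrthogonalIdempotents (D (Fin.last (L + 1)))] at h1
      exact (add_left_cancel h1).symm
    refine ⟨⟨⟨(F.1.1 (Fin.last (L + 1)).rev).1, (F.1.1 _).2.trans (flagDim_rev_last hd hdP)⟩,
      ⟨D (Fin.last (L + 1)), hD _, hdim⟩, D (Fin.last (L + 1)), hD _, hlay⟩, ?_⟩
    refine Subtype.ext (Subtype.ext (funext fun i => Subtype.ext ?_))
    rw [← Fin.rev_rev i, radFlag_apply, ← hD, ← hD, ← Submodule.restrictScalars_sup, hsup]

theorem isMorphism_radFlag :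
    KSpace.IsMorphism
      ((grVariety K P (Module.finrank K P - ∑ i, d i)).sub (layerGrass K P S e d))
      ((flagVariety K P (flagDim K P S e d)).sub (layerFlags K P S e d))
      (radFlag he hd hdP) := by
  classical
  have hA := KSpace.isSheaf_induced (Subtype.val : layerGrass K P S e d → _)
    (KSpace.isSheaf_grVariety (K := K) (V := P) (Module.finrank K P - ∑ i, d i))
  refine KSpace.isMorphism_to_induced hA (KSpace.isMorphism_to_induced hA
    (KSpace.isMorphism_induced_of_locally _ _ fun C => ?_))
  -- Choose a complement `W i` of `C` in `C + J ^ l P` that is contained in `J ^ l P`. For `C'` near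
  -- `C`, the space `C' + W i` has the dimension of `C' + J ^ l P`, and so is equal to it.
  have hW : ∀ i : Fin (L + 2), ∃ W : Submodule K P,
      W ≤ (radPow Λ P i.rev).restrictScalars K ∧ C.1.1 ⊓ W = ⊥ ∧
      C.1.1 ⊔ W = C.1.1 ⊔ (radPow Λ P i.rev).restrictScalars K :=
    fun i => exists_le_inf_eq_bot_and_sup_eq _ _
  choose W hWle hWinf hWsup using hW
  have hflag : ∀ (C : layerGrass K P S e d) (i : Fin (L + 2)),
      Module.finrank K ↥(C.1.1 ⊔ (radPow Λ P i.rev).restrictScalars K) =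
        flagDim K P S e d i := fun C i => ((radFlag he hd hdP C).1.1 i).2
  have hk : ∀ i, flagDim K P S e d i =
      (Module.finrank K P - ∑ i, d i) + Module.finrank K (W i) := by
    intro i
    have h1 := Submodule.finrank_sup_add_finrank_inf_eq C.1.1 (W i)
    have h2 : Module.finrank K C.1.1 = Module.finrank K P - ∑ i, d i := C.1.2
    rw [hWinf, finrank_bot, hWsup, hflag, h2] at h1
    exact h1
  let O : Set (Gr K P (Module.finrank K P - ∑ i, d i)) :=
    {C | ∀ i, flagDim K P S e d i ≤ Module.finrank K ↥(C.1 ⊔ W i)}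
  have hdimO : ∀ C ∈ O, ∀ i, Module.finrank K ↥(C.1 ⊔ W i) = flagDim K P S e d i := by
    intro C hC i
    refine le_antisymm ?_ (hC i)
    rw [hk]
    have h2 : Module.finrank K C.1 = Module.finrank K P - ∑ i, d i := C.2
    exact (Submodule.finrank_add_le_finrank_add_finrank C.1 (W i)).trans_eq
      (congrArg (· + Module.finrank K (W i)) h2)
  let F : Gr K P (Module.finrank K P - ∑ i, d i) → ∀ i, Gr K P (flagDim K P S e d i) :=
    fun C' => if h : C' ∈ O then fun i => ⟨C'.1 ⊔ W i, hdimO C' h i⟩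
      else (radFlag he hd hdP C).1.1
  have hF : ∀ C ∈ O, ∀ i, (F C i).1 = C.1 ⊔ W i := fun C hC i => by
    rw [show F C = _ from dif_pos hC]
  refine ⟨O, F, fun i => ?_, isMorphismOn_sup W hk F hF, fun C' hC' => ?_⟩
  · rw [hWsup, hflag]
  · refine funext fun i => Subtype.ext (Eq.symm ?_)
    rw [hF _ hC']
    refine Submodule.eq_of_le_of_finrank_le (sup_le_sup_left (hWle i) _) ?_
    exact (hflag C' i).trans_le (hC' i)

theorem isEmbedding_radFlag (hL : radIdeal Λ (L + 1) = ⊥) [∀ l, IsSemisimpleModule Λ (S l)] :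
    KSpace.IsEmbedding
      ((grVariety K P (Module.finrank K P - ∑ i, d i)).sub (layerGrass K P S e d))
      ((flagVariety K P (flagDim K P S e d)).sub (layerFlags K P S e d))
      (radFlag he hd hdP) := by
  have hA := KSpace.isSheaf_induced (Subtype.val : layerGrass K P S e d → _)
    (KSpace.isSheaf_grVariety (K := K) (V := P) (Module.finrank K P - ∑ i, d i))
  have hB : ((flagVariety K P (flagDim K P S e d)).sub (layerFlags K P S e d)).IsSheaf :=
    KSpace.isSheaf_induced _ (KSpace.isSheaf_induced _ KSpace.isSheaf_grProdVariety)
  refine ⟨isMorphism_radFlag he hd hdP, ?_,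
    KSpace.isMorphism_to_induced hA (isMorphism_radFlag he hd hdP), ?_⟩
  · have hset : Set.range (radFlag he hd hdP) =
        (fun F : layerFlags K P S e d => F.1.1) ⁻¹' ⋂ l : Fin (L + 2), {F | flagDim K P S e d l.rev ≤
          Module.finrank K ↥((F (Fin.last (L + 1)).rev).1 ⊔
            (radPow Λ P l).restrictScalars K)} := by
      ext F
      rw [mem_range_radFlag_iff he hd hdP hL]
      simp only [Set.mem_preimage, Set.mem_iInter, Set.mem_ofPred_eq]
    rw [hset]
    let := (grProdVariety K P (flagDim K P S e d)).top
    let := (flagVariety K P (flagDim K P S e d)).top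
    let := ((flagVariety K P (flagDim K P S e d)).sub (layerFlags K P S e d)).top
    refine IsOpen.isLocallyClosed ?_
    refine IsOpen.preimage (continuous_induced_dom.comp continuous_induced_dom) ?_
    exact isOpen_iInter_of_finite fun l => isOpen_le_finrank_sup _ _ _
  · let Ψ := Equiv.ofInjective _ (radFlag_injective (P := P) he hd hdP hL)
    refine ⟨Ψ.symm, Ψ.symm_apply_apply, Ψ.apply_symm_apply,
      KSpace.isMorphism_to_induced (KSpace.isSheaf_induced _ hB) ?_⟩
    have h := KSpace.isMorphism_comp_induced (KSpace.isMorphism_comp_induced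
      (KSpace.isMorphism_comp_induced (isMorphism_proj (K := K) (V := P)
        (k := flagDim K P S e d) (Fin.last (L + 1)).rev (flagDim_rev_last hd hdP))
        Subtype.val) Subtype.val) (Subtype.val : Set.range (radFlag he hd hdP) → _)
    refine (funext fun F => ?_ : Subtype.val ∘ Ψ.symm = _) ▸ h
    obtain ⟨C, rfl⟩ := Ψ.surjective F
    simp only [Function.comp_apply, Equiv.symm_apply_apply]
    exact Subtype.ext (radFlag_last he hd hdP hL C).symm

end RadicalFlag

theorem theorem3p9 {K : Type*} [Field K] [IsAlgClosed K]
    {Λ : Type*} [Ring Λ] [Algebra K Λ] [FiniteDimensional K Λ]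
    {n : ℕ} (e : Fin n → Λ) (he : IsBasicAlgebra K e)
    {L : ℕ} (hL : IsLeast {m : ℕ | radIdeal Λ (m + 1) = ⊥} L)
    (S : Fin (L + 1) → Type*) [∀ l, AddCommGroup (S l)] [∀ l, Module K (S l)]
    [∀ l, Module Λ (S l)] [∀ l, IsScalarTower K Λ (S l)] [∀ l, FiniteDimensional K (S l)]
    [∀ l, IsSemisimpleModule Λ (S l)]
    (d : Fin n → ℕ) (hd : ∑ l, dimVec K e (S l) = d)
    (P : Type*) [AddCommGroup P] [Module K P] [Module Λ P] [IsScalarTower K Λ P]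
    [FiniteDimensional K P] [Module.Projective Λ P]
    (hP : dimVec K e (P ⧸ radPow Λ P 1) = d) :
    IsClosed[(flagVariety K P (flagDim K P S e d)).top] (layerFlags K P S e d) ∧
    ∃ Φ : layerGrass K P S e d → layerFlags K P S e d,
      (∀ (C : layerGrass K P S e d) (l : Fin (L + 2)),
        ((Φ C).1.1 l.rev).1 = C.1.1 ⊔ (radPow Λ P l).restrictScalars K) ∧
      KSpace.IsEmbedding
        ((grVariety K P (Module.finrank K P - ∑ i, d i)).sub (layerGrass K P S e d))
        ((flagVariety K P (flagDim K P S e d)).sub (layerFlags K P S e d)) Φ := by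
  have hdP : d ≤ dimVec K e P := by
    rw [dimVec_eq_add he.complete.toOrthogonalIdempotents (radPow Λ P 1), hP]
    exact le_add_self
  have hdP' : ∑ i, d i ≤ Module.finrank K P := by
    rw [← sum_dimVec he.complete]
    exact Finset.sum_le_sum fun i _ => hdP i
  exact ⟨isClosed_layerFlags he hd hdP, radFlag he.complete hd hdP', radFlag_apply _ _ _,
    isEmbedding_radFlag _ _ _ hL.1⟩

end
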